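/- Let $k$ be an algebraically closed field of characteristic $p>0$. Let $X$ be a smooth projective $k$-variety (not necessarily irreducible), let $\mathcal L$ be an invertible sheaf on $X$, and let $Y\subseteq X$ be a smooth closed subvariety (again not necessarily irreducible) with ideal sheaf $\mathcal I\subseteq\mathcal O_X$. Let $F:X\to X$ be the absolute Frobenius morphism and let $\widetilde\sigma:F_*\mathcal O_X\to\mathcal O_X$ be a Frobenius splitting of $X$, i.e. an $\mathcal O_X$-linear map with $\widetilde\sigma(1)=1$. Suppose that $\widetilde\sigma$ maximally compatibly splits $Y$, i.e. $\widetilde\sigma(\mathcal I^{pm+1})\subseteq\mathcal I^{m+1}$ for all $m\ge 0$. Let $R(\mathcal L)=\bigoplus_{n\ge 0}\Gamma(X,\mathcal L^n)$ be the section ring of $\mathcal L$, where $\mathcal L^n=\mathcal L^{\otimes n}$, and for $m\ge 0$ let $J_m=\bigoplus_{n\ge 0}\Gamma(X,\mathcal I^m\otimes\mathcal L^n)$, regarded as an ideal of $R(\mathcal L)$. Let $\sigma:R(\mathcal L)\to R(\mathcal L)$ be the graded splitting induced by $\widetilde\sigma$: on $\Gamma(X,\mathcal L^{pn})$ it is the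 map to $\Gamma(X,\mathcal L^{n})$ induced on global sections by $\mathrm{id}\otimes\widetilde\sigma:\mathcal L^n\otimes_{\mathcal O_X}F_*\mathcal O_X\to\mathcal L^n$ under the isomorphism $\mathcal L^n\otimes_{\mathcal O_X}F_*\mathcal O_X\cong F_*(\mathcal L^{pn})$, $s\otimes a\mapsto a\,s^{p}$, and $\sigma$ is zero on $\Gamma(X,\mathcal L^j)$ for $p\nmid j$. Then $\sigma(J_{pm+1})\subseteq J_{m+1}$ for all $m\ge 0$. -/

import Mathlib

open CategoryTheory AlgebraicGeometry TopologicalSpace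
universe u
namespace FrobeniusSplit
noncomputable section

variable {X : Scheme.{u}}

/-- The stalk of a sheaf of modules. -/
abbrev stalk (L : X.Modules) (x : X) : Type u := ↑(TopCat.Presheaf.stalk (C := Ab) L.presheaf x)

/-- The underlying presheaf of modules, over the presheaf of commutative rings `𝒪_X`. -/
abbrev toPresheafOfModules (L : X.Modules) :
    PresheafOfModules.{u} (X.presheaf ⋙ forget₂ CommRingCat RingCat) := L.val

/-- The stalk of `L` at `x` is a module over the local ring `𝒪_{X,x}`. -/
instance stalkModule (L : X.Modules) (x : X) : Module (X.presheaf.stalk x) (stalk L x) :=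
  inferInstanceAs (Module (X.presheaf.stalk x)
    ↑(TopCat.Presheaf.stalk (C := Ab) (toPresheafOfModules L).presheaf x))

/-- The germ at `x` of a section of `L`. -/
def germ (L : X.Modules) {U : X.Opens} (x : X) (hx : x ∈ U) : Γ(L, U) →+ stalk L x :=
  (TopCat.Presheaf.germ (C := Ab) L.presheaf U x hx).hom

lemma germ_smul (L : X.Modules) {U : X.Opens} (x : X) (hx : x ∈ U) (a : Γ(X, U)) (s : Γ(L, U)) :
    germ L x hx (a • s) = X.presheaf.germ U x hx a • germ L x hx s :=
  PresheafOfModules.germ_smul (R := X.presheaf) L.val x U hx a s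

lemma germ_res (L : X.Modules) {U V : X.Opens} (h : U ≤ V) (x : X) (hx : x ∈ U) (s : Γ(L, V)) :
    germ L x hx (L.presheaf.map (homOfLE h).op s) = germ L x (h hx) s :=
  TopCat.Presheaf.germ_res_apply (C := Ab) L.presheaf (homOfLE h) x hx s

/-- `L` is an invertible sheaf: it is locally isomorphic to the structure sheaf. -/
def IsInvertible (L : X.Modules) : Prop :=
  ∀ x : X, ∃ U : X.Opens, x ∈ U ∧
    Nonempty (L.restrict U.ι ≅
      (SheafOfModules.unit (U : Scheme.{u}).ringCatSheaf : (U : Scheme.{u}).Modules))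

attribute [local instance] MvPolynomial.gradedAlgebra in
/-- Projective `n`-space over `k`, as `Proj k[x₀, …, xₙ]`. -/
def projectiveSpace (k : Type u) [Field k] (n : ℕ) : Scheme.{u} :=
  Proj (MvPolynomial.homogeneousSubmodule (Fin (n + 1)) k)

attribute [local instance] MvPolynomial.gradedAlgebra in
/-- The structure morphism of projective `n`-space over `k`. -/
def projectiveSpaceStructure (k : Type u) [Field k] (n : ℕ) :
    projectiveSpace k n ⟶ Spec (CommRingCat.of k) :=
  Proj.toSpecZero (MvPolynomial.homogeneousSubmodule (Fin (n + 1)) k) ≫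
    Spec.map (CommRingCat.ofHom
      (algebraMap k (MvPolynomial.homogeneousSubmodule (Fin (n + 1)) k 0)))

/-- A `k`-scheme is projective if it is a closed subscheme of some projective space over `k`. -/
def IsProjective {k : Type u} [Field k] (f : X ⟶ Spec (CommRingCat.of k)) : Prop :=
  ∃ (n : ℕ) (j : X ⟶ projectiveSpace k n),
    IsClosedImmersion j ∧ j ≫ projectiveSpaceStructure k n = f

lemma IsInvertible.exists_generator {L : X.Modules} (hL : IsInvertible L) (x : X) :
    ∃ U : X.Opens, x ∈ U ∧ ∃ t : Γ(L, U), ∀ (V : X.Opens) (h : V ≤ U),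
      Function.Bijective fun a : Γ(X, V) ↦ a • (L.presheaf.map (homOfLE h).op t : Γ(L, V)) := by
  obtain ⟨U, hx, ⟨e⟩⟩ := hL x
  let u : Γ(L, U.ι ''ᵁ ⊤) := (Scheme.Modules.Hom.app e.inv ⊤ (1 : Γ(U.toScheme, ⊤)))
  refine ⟨U.ι ''ᵁ ⊤, by simpa, u, ?_⟩
  intro V h
  obtain ⟨W, rfl⟩ : ∃ W : U.toScheme.Opens, V = U.ι ''ᵁ W := by
    refine ⟨U.ι ⁻¹ᵁ V, ?_⟩
    rw [Scheme.Hom.image_preimage_eq_opensRange_inf]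
    simpa using h
  have hn : (e.inv.app W (1 : Γ(U.toScheme, W)) : Γ(L, U.ι ''ᵁ W)) =
      L.presheaf.map (homOfLE h).op u := by
    have h1 := congr($(e.inv.mapPresheaf.naturality (homOfLE (le_top : W ≤ ⊤)).op)
      (1 : Γ(U.toScheme, ⊤)))
    refine Eq.trans ?_ h1
    refine congr(e.inv.app W $(?_))
    exact (map_one (U.toScheme.presheaf.map (homOfLE (le_top : W ≤ ⊤)).op).hom).symm
  have key : ∀ a : Γ(U.toScheme, W), (e.inv.app W a : Γ(L, U.ι ''ᵁ W)) =
      (show Γ(X, U.ι ''ᵁ W) from a) • (L.presheaf.map (homOfLE h).op u : Γ(L, U.ι ''ᵁ W)) := by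
    intro a
    have h2 := Scheme.Modules.Hom.app_smul e.inv (U := W) a (1 : Γ(U.toScheme, W))
    rw [← hn]
    have h3 : (a • (1 : Γ(U.toScheme, W)) : Γ(U.toScheme, W)) = a := mul_one a
    refine Eq.trans (congr(e.inv.app W $(h3.symm))) (h2.trans ?_)
    have h4 := congr($(Scheme.Modules.smul_restrictAppIso_hom U.ι L W a)
      (e.inv.app W (1 : Γ(U.toScheme, W))))
    refine Eq.trans h4 ?_
    simp
    rfl
  have hb : Function.Bijective (e.inv.app W) := by
    have h5 : IsIso (Scheme.Modules.Hom.app e.inv W) :=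
      Scheme.Modules.Hom.isIso_iff_isIso_app.mp (Iso.isIso_inv e) W
    exact ConcreteCategory.bijective_of_isIso (Scheme.Modules.Hom.app e.inv W)
  have he : (fun a : Γ(X, U.ι ''ᵁ W) ↦
      a • (L.presheaf.map (homOfLE h).op u : Γ(L, U.ι ''ᵁ W))) = e.inv.app W :=
    funext fun a ↦ (key a).symm
  rw [he]
  exact hb

section algebra
variable (A : Type u) (M : Type u) [CommRing A] [AddCommGroup M] [Module A M]

/-- The tensor power `M^{⊗n}`, as the degree-`n` part of the tensor algebra of `M` over `A`. -/
abbrev tensorPower (n : ℕ) : Submodule A (TensorAlgebra A M) :=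
  LinearMap.range (TensorAlgebra.ι A (M := M)) ^ n

variable {A M}

/-- The `p`-th power map `M^{⊗m} → M^{⊗pm}`, `s ↦ s^{⊗p}`. -/
def pthPower (p m : ℕ) (s : tensorPower A M m) : tensorPower A M (p * m) :=
  ⟨(s : TensorAlgebra A M) ^ p, by
    rw [mul_comm p m, tensorPower, pow_mul]
    exact Submodule.pow_mem_pow _ s.2 p⟩

lemma mem_tensorPower {t : M} (ht : Function.Bijective fun a : A ↦ a • t) {n : ℕ}
    {s : TensorAlgebra A M} :
    s ∈ tensorPower A M n ↔ ∃ a : A, s = a • (TensorAlgebra.ι A t) ^ n := by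
  have h : LinearMap.range (TensorAlgebra.ι A (M := M)) =
      Submodule.span A {TensorAlgebra.ι A t} := by
    ext y
    rw [Submodule.mem_span_singleton, LinearMap.mem_range]
    constructor
    · rintro ⟨z, rfl⟩
      obtain ⟨a, rfl⟩ := ht.2 z
      exact ⟨a, by simp⟩
    · rintro ⟨a, rfl⟩
      exact ⟨a • t, by simp⟩
  rw [tensorPower, h, Submodule.span_pow, Set.singleton_pow, Submodule.mem_span_singleton]
  simp only [eq_comm]

lemma smul_pow_injective {t : M} (ht : Function.Bijective fun a : A ↦ a • t) (n : ℕ) {a b : A}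
    (h : a • (TensorAlgebra.ι A t) ^ n = b • (TensorAlgebra.ι A t) ^ n) : a = b := by
  let e : A ≃ₗ[A] M := LinearEquiv.ofBijective (LinearMap.toSpanSingleton A M t) ht
  have he : e.symm t = 1 := by
    rw [LinearEquiv.symm_apply_eq]
    exact (one_smul A t).symm
  have := congr(TensorAlgebra.lift A (e.symm : M →ₗ[A] A) $h)
  simpa [he] using this

/-- Let `M` be free of rank one over `A` and let `φ : F_*A → A` be `A`-linear, that is,
`φ (a ^ p * b) = a * φ b`. As `s ⊗ a ↦ a • s ^ p` identifies `M^{⊗m} ⊗ F_*A` with `F_*(M^{⊗pm})`,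
the map `id ⊗ φ : M^{⊗m} ⊗ F_*A → M^{⊗m}` becomes the unique additive map
`M^{⊗pm} → M^{⊗m}` sending `a • s ^ p` to `φ a • s`. -/
theorem existsUnique_tensorPowerSplit {p : ℕ} (φ : A →+ A)
    (hφ : ∀ a b, φ (a ^ p * b) = a * φ b) (hM : ∃ t : M, Function.Bijective fun a : A ↦ a • t)
    (m : ℕ) :
    ∃! τ : tensorPower A M (p * m) →+ tensorPower A M m,
      ∀ (a : A) (s : tensorPower A M m), τ (a • pthPower p m s) = φ a • s := by
  obtain ⟨t, ht⟩ := hM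
  have H : ∀ n, ∀ s : tensorPower A M n, ∃ a : A, (s : TensorAlgebra A M) =
    a • (TensorAlgebra.ι A t) ^ n := fun n s ↦ (mem_tensorPower ht).1 s.2
  choose c hc using H
  have hc' : ∀ n (s : tensorPower A M n) (a : A),
      (s : TensorAlgebra A M) = a • (TensorAlgebra.ι A t) ^ n → c n s = a :=
    fun n s a h ↦ smul_pow_injective ht n ((hc n s).symm.trans h)
  let g : tensorPower A M m := ⟨(TensorAlgebra.ι A t) ^ m, (mem_tensorPower ht).2 ⟨1, by simp⟩⟩
  have hg : ∀ s : tensorPower A M (p * m), s = c _ s • pthPower p m g := by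
    intro s
    ext
    simpa [pthPower, g, ← pow_mul, mul_comm m p] using hc _ s
  refine ⟨
    { toFun s := φ (c _ s) • g
      map_zero' := by
        rw [hc' (p * m) 0 0 (by simp)]
        simp
      map_add' s s' := by
        rw [hc' (p * m) (s + s') (c _ s + c _ s') (by
          rw [Submodule.coe_add, add_smul, ← hc, ← hc])]
        simp [add_smul] }, ?_, ?_⟩
  · intro a s
    have h1 : c (p * m) (a • pthPower p m s) = (c m s) ^ p * a := by
      apply hc'
      simp only [Submodule.coe_smul, pthPower]
      rw [hc m s, smul_pow, ← pow_mul, smul_smul, mul_comm m p, mul_comm a]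
    have h2 : s = c m s • g := by
      ext
      exact hc m s
    simp only [AddMonoidHom.coe_mk, ZeroHom.coe_mk, h1, hφ]
    conv_rhs => rw [h2]
    rw [smul_smul, mul_comm]
  · intro τ hτ
    ext1 s
    conv_lhs => rw [hg s]
    exact hτ _ _

/-- The map `M^{⊗pm} ≅ M^{⊗m} ⊗ F_*A → M^{⊗m}` given by `id ⊗ φ`, for `M` free of rank one. -/
def tensorPowerSplit {p : ℕ} (φ : A →+ A)
    (hφ : ∀ a b, φ (a ^ p * b) = a * φ b) (hM : ∃ t : M, Function.Bijective fun a : A ↦ a • t)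
    (m : ℕ) : tensorPower A M (p * m) →+ tensorPower A M m :=
  (existsUnique_tensorPowerSplit φ hφ hM m).choose

lemma tensorPowerSplit_smul_pthPower {p : ℕ} (φ : A →+ A)
    (hφ : ∀ a b, φ (a ^ p * b) = a * φ b) (hM : ∃ t : M, Function.Bijective fun a : A ↦ a • t)
    (m : ℕ) (a : A) (s : tensorPower A M m) :
    tensorPowerSplit φ hφ hM m (a • pthPower p m s) = φ a • s :=
  (existsUnique_tensorPowerSplit φ hφ hM m).choose_spec.1 a s

end algebra

/-- A Frobenius splitting of `X`: an `𝒪_X`-linear map `σ : F_*𝒪_X → 𝒪_X` with `σ 1 = 1`. The absolute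
Frobenius `F` is the identity on points, so `F_*𝒪_X` is the sheaf of abelian groups `𝒪_X` on which
a function `a` acts as multiplication by `a ^ p`. -/
structure FrobeniusSplitting (X : Scheme.{u}) (p : ℕ) where
  app (U : X.Opens) : Γ(X, U) →+ Γ(X, U)
  app_res {U V : X.Opens} (h : U ≤ V) (a : Γ(X, V)) :
    app U (X.presheaf.map (homOfLE h).op a) = X.presheaf.map (homOfLE h).op (app V a)
  app_pow_mul {U : X.Opens} (a b : Γ(X, U)) : app U (a ^ p * b) = a * app U b
  app_one (U : X.Opens) : app U 1 = 1

namespace FrobeniusSplitting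
variable {p : ℕ} (φ : FrobeniusSplitting X p)

/-- A Frobenius splitting induces a unique map on each local ring. -/
theorem existsUnique_stalkMap (x : X) :
    ∃! ψ : X.presheaf.stalk x →+ X.presheaf.stalk x,
      ∀ (U : X.Opens) (hx : x ∈ U) (a : Γ(X, U)),
        ψ (X.presheaf.germ U x hx a) = X.presheaf.germ U x hx (φ.app U a) := by
  have H := fun a : X.presheaf.stalk x ↦ TopCat.Presheaf.exists_germ_eq X.presheaf a
  choose U hU s hs using H
  have key : ∀ (V : X.Opens) (hx : x ∈ V) (a : Γ(X, V)) (b : X.presheaf.stalk x),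
      X.presheaf.germ V x hx a = b →
      X.presheaf.germ (U b) x (hU b) (φ.app _ (s b)) = X.presheaf.germ V x hx (φ.app V a) := by
    intro V hx a b hab
    obtain ⟨W, hW, iU, iV, h⟩ := TopCat.Presheaf.germ_eq X.presheaf x (hU b) hx (s b) a
      ((hs b).trans hab.symm)
    have h' := congr(X.presheaf.germ W x hW (φ.app W $h))
    rw [show iU = homOfLE iU.le from rfl, show iV = homOfLE iV.le from rfl, φ.app_res,
      φ.app_res, TopCat.Presheaf.germ_res_apply, TopCat.Presheaf.germ_res_apply] at h'
    exact h'
  refine ⟨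
    { toFun b := X.presheaf.germ (U b) x (hU b) (φ.app _ (s b))
      map_zero' := by
        rw [key ⊤ trivial 0 0 (by simp)]
        simp
      map_add' a b := by
        have hW : x ∈ U a ⊓ U b := ⟨hU a, hU b⟩
        rw [key (U a ⊓ U b) hW
          (X.presheaf.map (homOfLE inf_le_left).op (s a) +
            X.presheaf.map (homOfLE inf_le_right).op (s b)) (a + b) (by
            rw [map_add, TopCat.Presheaf.germ_res_apply, TopCat.Presheaf.germ_res_apply, hs, hs]),
          map_add, map_add, φ.app_res, φ.app_res, TopCat.Presheaf.germ_res_apply,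
          TopCat.Presheaf.germ_res_apply] }, ?_, ?_⟩
  · intro V hx a
    exact key V hx a _ rfl
  · intro ψ hψ
    ext b
    conv_lhs => rw [← hs b]
    exact hψ _ _ _

/-- The map `𝒪_{X,x} → 𝒪_{X,x}` on stalks induced by a Frobenius splitting. -/
def stalkMap (x : X) : X.presheaf.stalk x →+ X.presheaf.stalk x :=
  (φ.existsUnique_stalkMap x).choose

lemma stalkMap_germ {x : X} {U : X.Opens} (hx : x ∈ U) (a : Γ(X, U)) :
    φ.stalkMap x (X.presheaf.germ U x hx a) = X.presheaf.germ U x hx (φ.app U a) :=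
  (φ.existsUnique_stalkMap x).choose_spec.1 U hx a

lemma stalkMap_pow_mul (x : X) (a b : X.presheaf.stalk x) :
    φ.stalkMap x (a ^ p * b) = a * φ.stalkMap x b := by
  obtain ⟨U, hU, a, rfl⟩ := TopCat.Presheaf.exists_germ_eq X.presheaf a
  obtain ⟨V, hV, b, rfl⟩ := TopCat.Presheaf.exists_germ_eq X.presheaf b
  have hW : x ∈ U ⊓ V := ⟨hU, hV⟩
  rw [← TopCat.Presheaf.germ_res_apply X.presheaf (homOfLE inf_le_left) x hW,
    ← TopCat.Presheaf.germ_res_apply X.presheaf (homOfLE inf_le_right) x hW, ← map_pow, ← map_mul,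
    stalkMap_germ, stalkMap_germ, φ.app_pow_mul, map_mul]

end FrobeniusSplitting

section sections

/-- The tensor algebra of the stalk `L_x`, whose degree-`n` part is the stalk `L_x^{⊗n}` of `L^n`. -/
abbrev stalkTensorAlgebra (L : X.Modules) (x : X) : Type u :=
  TensorAlgebra (X.presheaf.stalk x) (stalk L x)

/-- For an affine open `U`, the image of `I(U) ⊗ L(U)^{⊗n}` in the families of elements of the stalks
`L_y^{⊗n}`, `y ∈ U`: all finite sums of tensors `a • b₁ ⊗ ⋯ ⊗ bₙ` with `a ∈ I(U)`, `bᵢ ∈ L(U)`. -/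
def localTwistedTensors (I : X.IdealSheafData) (L : X.Modules) (n : ℕ) (U : X.affineOpens) :
    AddSubgroup (∀ y : U.1, stalkTensorAlgebra L y) :=
  AddSubgroup.closure {s : ∀ y : U.1, stalkTensorAlgebra L y | ∃ a ∈ I.ideal U,
    ∃ b : Fin n → Γ(L, U.1), s = fun y : U.1 ↦
    X.presheaf.germ U.1 y y.2 a •
      TensorAlgebra.tprod (X.presheaf.stalk y) (stalk L y) n fun i ↦ germ L y y.2 (b i)}

lemma res_mem_localTwistedTensors {I : X.IdealSheafData} {L : X.Modules} {n : ℕ}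
    {U V : X.affineOpens} (h : V.1 ≤ U.1) {s : ∀ y : U.1, stalkTensorAlgebra L y}
    (hs : s ∈ localTwistedTensors I L n U) :
    (fun y : V.1 ↦ s ⟨y, h y.2⟩) ∈ localTwistedTensors I L n V := by
  induction hs using AddSubgroup.closure_induction with
  | mem s hs =>
    obtain ⟨a, ha, b, rfl⟩ := hs
    refine AddSubgroup.subset_closure ⟨X.presheaf.map (homOfLE h).op a, ?_,
      fun i ↦ L.presheaf.map (homOfLE h).op (b i), ?_⟩
    · rw [← I.map_ideal h]
      exact Ideal.mem_map_of_mem _ ha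
    · funext y
      exact congrArg₂ (· • ·)
        (TopCat.Presheaf.germ_res_apply X.presheaf (homOfLE h) y.1 y.2 a).symm
        (congrArg _ (funext fun i ↦ (germ_res L h y.1 y.2 (b i)).symm))
  | zero => exact zero_mem _
  | add s t _ _ hs ht => exact add_mem hs ht
  | neg s _ hs => exact neg_mem hs

lemma mul_mem_localTwistedTensors {I J : X.IdealSheafData} {L : X.Modules} {m n : ℕ}
    {U : X.affineOpens} {s t : ∀ y : U.1, stalkTensorAlgebra L y}
    (hs : s ∈ localTwistedTensors I L m U) (ht : t ∈ localTwistedTensors J L n U) :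
    s * t ∈ localTwistedTensors (I * J) L (m + n) U := by
  induction hs using AddSubgroup.closure_induction with
  | mem s hs =>
    induction ht using AddSubgroup.closure_induction with
    | mem t ht =>
      obtain ⟨a, ha, b, rfl⟩ := hs
      obtain ⟨a', ha', b', rfl⟩ := ht
      refine AddSubgroup.subset_closure ⟨a * a', Ideal.mul_mem_mul ha ha', Fin.append b b', ?_⟩
      ext y
      simp only [Pi.mul_apply, map_mul, TensorAlgebra.tprod_apply, smul_mul_smul_comm]
      rw [← List.prod_append, ← List.ofFn_fin_append]
      congr 3
      ext i
      refine Fin.addCases (fun i ↦ ?_) (fun i ↦ ?_) i <;> simp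
    | zero => simp
    | add t t' _ _ ht ht' => rw [mul_add]; exact add_mem ht ht'
    | neg t _ ht => rw [mul_neg]; exact neg_mem ht
  | zero => simp
  | add s s' _ _ hs hs' => rw [add_mul]; exact add_mem hs hs'
  | neg s _ hs => rw [neg_mul]; exact neg_mem hs

lemma exists_affine_le {U : X.Opens} {x : X} (hx : x ∈ U) :
    ∃ V : X.affineOpens, x ∈ V.1 ∧ V.1 ≤ U := by
  obtain ⟨V, hV, hxV, hVU⟩ := Opens.isBasis_iff_nbhd.mp X.isBasis_affineOpens hx
  exact ⟨⟨V, hV⟩, hxV, hVU⟩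

/-- The global sections of the subsheaf `I · L^n` of `L^n`, i.e. of the image of `I ⊗ L^n → L^n`
(isomorphic to `I ⊗ L^n` for invertible `L`). As in the construction of the sheaf associated to a
presheaf, a section is a family of elements of the stalks which locally comes from a section of the
tensor product presheaf. -/
def twistedSections (I : X.IdealSheafData) (L : X.Modules) (n : ℕ) :
    AddSubgroup (∀ x : X, stalkTensorAlgebra L x) where
  carrier := {s | ∀ x : X, ∃ U : X.affineOpens, x ∈ U.1 ∧
    (fun y : U.1 ↦ s y) ∈ localTwistedTensors I L n U}
  zero_mem' x := by
    obtain ⟨V, hV, -⟩ := exists_affine_le (show x ∈ (⊤ : X.Opens) from trivial)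
    exact ⟨V, hV, zero_mem _⟩
  add_mem' {s t} hs ht x := by
    obtain ⟨U, hU, hs⟩ := hs x
    obtain ⟨V, hV, ht⟩ := ht x
    obtain ⟨W, hW, hWUV⟩ := exists_affine_le (show x ∈ U.1 ⊓ V.1 from ⟨hU, hV⟩)
    exact ⟨W, hW, add_mem (res_mem_localTwistedTensors (hWUV.trans inf_le_left) hs)
      (res_mem_localTwistedTensors (hWUV.trans inf_le_right) ht)⟩
  neg_mem' {s} hs x := by
    obtain ⟨U, hU, hs⟩ := hs x
    exact ⟨U, hU, neg_mem hs⟩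

lemma mul_mem_twistedSections {I J : X.IdealSheafData} {L : X.Modules} {m n : ℕ}
    {s t : ∀ x : X, stalkTensorAlgebra L x}
    (hs : s ∈ twistedSections I L m) (ht : t ∈ twistedSections J L n) :
    s * t ∈ twistedSections (I * J) L (m + n) := by
  intro x
  obtain ⟨U, hU, hs⟩ := hs x
  obtain ⟨V, hV, ht⟩ := ht x
  obtain ⟨W, hW, hWUV⟩ := exists_affine_le (show x ∈ U.1 ⊓ V.1 from ⟨hU, hV⟩)
  exact ⟨W, hW, mul_mem_localTwistedTensors
    (res_mem_localTwistedTensors (hWUV.trans inf_le_left) hs)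
    (res_mem_localTwistedTensors (hWUV.trans inf_le_right) ht)⟩

/-- The global sections `Γ(X, L^n)` of the `n`-th tensor power of `L`. -/
abbrev tensorPowerSections (L : X.Modules) (n : ℕ) :
    AddSubgroup (∀ x : X, stalkTensorAlgebra L x) :=
  twistedSections ⊤ L n

/-- The tensor product of sections maps `Γ(X, L^m) × Γ(X, L^n)` to `Γ(X, L^(m+n))`. -/
instance (L : X.Modules) : SetLike.GradedMonoid (tensorPowerSections L) where
  one_mem x := by
    obtain ⟨V, hV, -⟩ := exists_affine_le (show x ∈ (⊤ : X.Opens) from trivial)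
    refine ⟨V, hV, AddSubgroup.subset_closure ⟨1, trivial, Fin.elim0, ?_⟩⟩
    ext y
    simp
  mul_mem m n s t hs ht := by
    simpa using mul_mem_twistedSections hs ht

/-- The section ring `R(L) = ⨁ₙ Γ(X, L^n)`, with multiplication induced by the tensor product. -/
abbrev sectionRing (L : X.Modules) : Type u := DirectSum ℕ fun n ↦ tensorPowerSections L n

/-- The ideal `J_m = ⨁ₙ Γ(X, I^m ⊗ L^n)` of the section ring `R(L)`. -/
def vanishingIdeal (I : X.IdealSheafData) (L : X.Modules) (m : ℕ) : Ideal (sectionRing L) where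
  carrier := {r | ∀ n, (r n : ∀ x : X, stalkTensorAlgebra L x) ∈ twistedSections (I ^ m) L n}
  zero_mem' n := zero_mem _
  add_mem' hr hr' n := add_mem (hr n) (hr' n)
  smul_mem' r r' hr' n := by
    classical
    rw [smul_eq_mul, DirectSum.coe_mul_apply]
    refine sum_mem fun ij hij ↦ ?_
    obtain rfl := (Finset.mem_filter.1 hij).2
    simpa using mul_mem_twistedSections (r ij.1).2 (hr' ij.2)

lemma mem_tensorPower_of_mem_twistedSections {I : X.IdealSheafData} {L : X.Modules} {n : ℕ}
    {s : ∀ x : X, stalkTensorAlgebra L x} (hs : s ∈ twistedSections I L n) (x : X) :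
    s x ∈ tensorPower (X.presheaf.stalk x) (stalk L x) n := by
  obtain ⟨U, hU, hs⟩ := hs x
  suffices h : ∀ s' ∈ localTwistedTensors I L n U, ∀ y : U.1,
      s' y ∈ tensorPower (X.presheaf.stalk y) (stalk L y) n from h _ hs ⟨x, hU⟩
  intro s' hs' y
  induction hs' using AddSubgroup.closure_induction with
  | mem s hs =>
    obtain ⟨a, -, b, rfl⟩ := hs
    refine Submodule.smul_mem _ _ ?_
    rw [TensorAlgebra.tprod_apply]
    have := SetLike.list_prod_ofFn_mem_graded (A := fun k : ℕ ↦
      tensorPower (X.presheaf.stalk y) (stalk L y) k) (fun _ : Fin n ↦ 1)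
      (fun i : Fin n ↦ TensorAlgebra.ι (X.presheaf.stalk y) (germ L y y.2 (b i)))
      (fun i ↦ by simp [tensorPower])
    simpa using this
  | zero => exact zero_mem _
  | add s t _ _ hs ht => exact add_mem hs ht
  | neg s _ hs => exact neg_mem hs

lemma IsInvertible.exists_affine_generator {L : X.Modules} (hL : IsInvertible L) (x : X)
    (U : X.Opens) (hx : x ∈ U) :
    ∃ V : X.affineOpens, x ∈ V.1 ∧ V.1 ≤ U ∧ ∃ t : Γ(L, V.1),
      (Function.Bijective fun a : Γ(X, V.1) ↦ a • t) ∧ ∀ (y : X) (hy : y ∈ V.1),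
        Function.Bijective fun a : X.presheaf.stalk y ↦ a • germ L y hy t := by
  obtain ⟨W, hW, t, ht⟩ := hL.exists_generator x
  obtain ⟨V, hV, hVW⟩ := exists_affine_le (show x ∈ U ⊓ W from ⟨hx, hW⟩)
  have hVW' : V.1 ≤ W := hVW.trans inf_le_right
  refine ⟨V, hV, hVW.trans inf_le_left, L.presheaf.map (homOfLE hVW').op t, ht _ hVW', ?_⟩
  intro y hy
  rw [germ_res]
  constructor
  · intro a b hab
    obtain ⟨A, hA, a, rfl⟩ := TopCat.Presheaf.exists_germ_eq X.presheaf a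
    obtain ⟨B, hB, b, rfl⟩ := TopCat.Presheaf.exists_germ_eq X.presheaf b
    have hC : y ∈ (A ⊓ B) ⊓ W := ⟨⟨hA, hB⟩, hVW' hy⟩
    have h1 := TopCat.Presheaf.germ_res_apply X.presheaf
      (homOfLE (inf_le_left.trans inf_le_left : (A ⊓ B) ⊓ W ≤ A)) y hC a
    have h2 := TopCat.Presheaf.germ_res_apply X.presheaf
      (homOfLE (inf_le_left.trans inf_le_right : (A ⊓ B) ⊓ W ≤ B)) y hC b
    have h3 := germ_res L (inf_le_right : (A ⊓ B) ⊓ W ≤ W) y hC t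
    rw [← h1, ← h2, ← h3] at hab
    simp only [← germ_smul] at hab
    obtain ⟨D, hD, i, j, hij⟩ := TopCat.Presheaf.germ_eq (C := Ab) L.presheaf y hC hC _ _ hab
    have hDW : D ≤ W := i.le.trans inf_le_right
    rw [show i = homOfLE i.le from rfl, show j = homOfLE i.le from rfl,
      Scheme.Modules.map_smul, Scheme.Modules.map_smul] at hij
    have h4 : L.presheaf.map (homOfLE i.le).op (L.presheaf.map
        (homOfLE (inf_le_right : (A ⊓ B) ⊓ W ≤ W)).op t) = L.presheaf.map (homOfLE hDW).op t := by
      rw [← ConcreteCategory.comp_apply, ← Functor.map_comp]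
      rfl
    rw [h4] at hij
    have h5 := congr(X.presheaf.germ D y hD $((ht D hDW).1 hij))
    rwa [TopCat.Presheaf.germ_res_apply, TopCat.Presheaf.germ_res_apply,
      TopCat.Presheaf.germ_res_apply, TopCat.Presheaf.germ_res_apply] at h5
  · intro z
    obtain ⟨A, hA, z, rfl⟩ := TopCat.Presheaf.exists_germ_eq (C := Ab) L.presheaf z
    have hC : y ∈ A ⊓ W := ⟨hA, hVW' hy⟩
    obtain ⟨a, ha⟩ := (ht (A ⊓ W) inf_le_right).2 (L.presheaf.map (homOfLE inf_le_left).op z)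
    refine ⟨X.presheaf.germ _ y hC a, ?_⟩
    have h1 := congr(germ L y hC $ha)
    simp only [germ_smul, germ_res] at h1
    exact h1

lemma IsInvertible.exists_stalk_generator {L : X.Modules} (hL : IsInvertible L) (x : X) :
    ∃ t : stalk L x, Function.Bijective fun a : X.presheaf.stalk x ↦ a • t := by
  obtain ⟨V, hV, -, t, -, ht⟩ := hL.exists_affine_generator x ⊤ trivial
  exact ⟨_, ht x hV⟩

lemma exists_coordinate {I : X.IdealSheafData} {L : X.Modules} {n : ℕ} {V : X.affineOpens}
    {t : Γ(L, V.1)} (ht : Function.Bijective fun a : Γ(X, V.1) ↦ a • t)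
    {s : ∀ y : V.1, stalkTensorAlgebra L y} (hs : s ∈ localTwistedTensors I L n V) :
    ∃ a ∈ I.ideal V, ∀ y : V.1, s y = X.presheaf.germ V.1 y y.2 a •
      TensorAlgebra.ι (X.presheaf.stalk y) (germ L y y.2 t) ^ n := by
  induction hs using AddSubgroup.closure_induction with
  | mem s hs =>
    obtain ⟨a, ha, b, rfl⟩ := hs
    choose c hc using fun i ↦ ht.2 (b i)
    refine ⟨a * ∏ i, c i, Ideal.mul_mem_right _ _ ha, fun y ↦ ?_⟩
    simp only [← hc, germ_smul]
    rw [MultilinearMap.map_smul_univ, smul_smul, TensorAlgebra.tprod_apply, map_mul, map_prod]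
    simp
  | zero => exact ⟨0, zero_mem _, fun y ↦ by simp⟩
  | add s s' _ _ hs hs' =>
    obtain ⟨a, ha, h⟩ := hs
    obtain ⟨a', ha', h'⟩ := hs'
    exact ⟨a + a', add_mem ha ha', fun y ↦ by simp [h, h', add_smul]⟩
  | neg s _ hs =>
    obtain ⟨a, ha, h⟩ := hs
    exact ⟨-a, neg_mem ha, fun y ↦ by simp [h]⟩

lemma smul_pow_mem_localTwistedTensors {I : X.IdealSheafData} {L : X.Modules} (n : ℕ)
    {V : X.affineOpens} {a : Γ(X, V.1)} (ha : a ∈ I.ideal V) (t : Γ(L, V.1)) :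
    (fun y : V.1 ↦ X.presheaf.germ V.1 y y.2 a •
      TensorAlgebra.ι (X.presheaf.stalk y) (germ L y y.2 t) ^ n) ∈ localTwistedTensors I L n V := by
  refine AddSubgroup.subset_closure ⟨a, ha, fun _ ↦ t, ?_⟩
  funext y
  simp [TensorAlgebra.tprod_apply]

variable {p : ℕ} (φ : FrobeniusSplitting X p) {L : X.Modules} (hL : IsInvertible L)

namespace FrobeniusSplitting

/-- The map `id ⊗ σ : L^{pm} ≅ L^m ⊗ F_*𝒪_X → L^m` on stalks at `x`. -/
def stalkSplit (m : ℕ) (x : X) :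
    tensorPower (X.presheaf.stalk x) (stalk L x) (p * m) →+
      tensorPower (X.presheaf.stalk x) (stalk L x) m :=
  tensorPowerSplit (φ.stalkMap x) (φ.stalkMap_pow_mul x) (hL.exists_stalk_generator x) m

lemma stalkSplit_mem (m : ℕ) {s : ∀ x : X, stalkTensorAlgebra L x}
    (hs : s ∈ tensorPowerSections L (p * m)) :
    (fun x ↦ (φ.stalkSplit hL m x ⟨s x, mem_tensorPower_of_mem_twistedSections hs x⟩ :
      stalkTensorAlgebra L x)) ∈ tensorPowerSections L m := by
  intro x
  obtain ⟨U, hU, hsU⟩ := hs x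
  obtain ⟨V, hV, hVU, t, ht, ht'⟩ := hL.exists_affine_generator x U.1 hU
  obtain ⟨a, -, ha⟩ := exists_coordinate ht (res_mem_localTwistedTensors hVU hsU)
  refine ⟨V, hV, ?_⟩
  convert smul_pow_mem_localTwistedTensors (I := ⊤) m (a := φ.app V.1 a) trivial t using 1
  funext y
  have h1 : TensorAlgebra.ι (X.presheaf.stalk y.1) (germ L y.1 y.2 t) ^ m ∈
      tensorPower (X.presheaf.stalk y.1) (stalk L y.1) m :=
    (mem_tensorPower (ht' y.1 y.2)).2 ⟨1, by simp⟩
  have h2 := tensorPowerSplit_smul_pthPower (φ.stalkMap y.1) (φ.stalkMap_pow_mul y.1)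
    (hL.exists_stalk_generator y.1) m (X.presheaf.germ V.1 y.1 y.2 a) ⟨_, h1⟩
  rw [stalkMap_germ] at h2
  refine Eq.trans ?_ congr(($h2 : stalkTensorAlgebra L y.1))
  refine congr((tensorPowerSplit (φ.stalkMap y.1) (φ.stalkMap_pow_mul y.1)
    (hL.exists_stalk_generator y.1) m $(?_) : stalkTensorAlgebra L y.1))
  ext
  simp only [pthPower, Submodule.coe_smul, ← pow_mul]
  rw [mul_comm m p]
  exact ha y

/-- The map `Γ(X, L^{pm}) → Γ(X, L^m)` induced by `id ⊗ σ : L^m ⊗ F_*𝒪_X → L^m`. -/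
def sectionSplit (m : ℕ) : tensorPowerSections L (p * m) →+ tensorPowerSections L m where
  toFun s := ⟨_, φ.stalkSplit_mem hL m s.2⟩
  map_zero' := by
    ext x
    exact congr(($(map_zero (φ.stalkSplit hL m x)) : stalkTensorAlgebra L x))
  map_add' s s' := by
    ext x
    exact congrArg Subtype.val (map_add (φ.stalkSplit hL m x)
      ⟨s.1 x, mem_tensorPower_of_mem_twistedSections s.2 x⟩
      ⟨s'.1 x, mem_tensorPower_of_mem_twistedSections s'.2 x⟩)

/-- The graded splitting of the section ring induced by a Frobenius splitting of `X`: it maps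
`Γ(X, L^{pm})` to `Γ(X, L^m)` by `sectionSplit`, and is zero in the degrees not divisible by `p`. -/
def sectionRingSplit [Fact p.Prime] : sectionRing L →+ sectionRing L where
  toFun r := DFinsupp.mapRange (fun m ↦ φ.sectionSplit hL m) (fun m ↦ map_zero _)
    (DFinsupp.comapDomain (fun m ↦ p * m) (mul_right_injective₀ (Fact.out : p.Prime).ne_zero) r)
  map_zero' := by
    ext m : 1
    simp
  map_add' r r' := by
    ext m : 1
    simp

lemma sectionRingSplit_apply [Fact p.Prime] (r : sectionRing L) (m : ℕ) :
    φ.sectionRingSplit hL r m = φ.sectionSplit hL m (r (p * m)) := rfl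

/-- The closed subscheme with ideal sheaf `I` is maximally compatibly split by `σ`:
`σ(I^{pm+1}) ⊆ I^{m+1}` for all `m ≥ 0`. -/
def MaximallyCompatiblySplits (I : X.IdealSheafData) : Prop :=
  ∀ (m : ℕ) (U : X.affineOpens), ∀ a ∈ (I ^ (p * m + 1)).ideal U,
    φ.app U.1 a ∈ (I ^ (m + 1)).ideal U

end FrobeniusSplitting

end sections
end
end FrobeniusSplit

namespace FrobeniusSplit.FrobeniusSplitting

/-! The claim is local on `X` and separate in each degree. Near a point, `L` has a generator `t` on
an affine open `V`, so a section of `I · L^{pn}` is `a • t^{pn} = a • (t^n)^p` with `a ∈ I(V)`.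
Since `id ⊗ φ` sends `a • s^p` to `φ a • s`, the image is `φ a • t^n`: in the coordinates given by
`t`, the splitting of sections is just `φ` applied to the coefficient. Hence any inclusion `φ(I) ⊆
J` passes to sections twisted by powers of `L`.

The lemma below is stated for an arbitrary pair `I`, `J`; the theorem is the case where `I` and `J`
are the powers `pm + 1` and `m + 1` of the ideal sheaf of `Y`, for which `φ(I) ⊆ J` is maximal
compatibility. Three facts carry the argument: `exists_affine_generator` supplies `V` and `t`,
`exists_coordinate` extracts a coefficient lying in the ideal, and `tensorPowerSplit_smul_pthPower`
evaluates the splitting on stalks. -/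

/-- If a Frobenius splitting `φ` maps the ideal sheaf `I` into `J`, the induced map
`Γ(X, L^{pn}) → Γ(X, L^n)` sends sections of `I · L^{pn}` to sections of `J · L^n`. -/
theorem sectionSplit_mem_twistedSections {X : Scheme.{u}} {p : ℕ} (φ : FrobeniusSplitting X p)
    {L : X.Modules} (hL : IsInvertible L) {I J : X.IdealSheafData}
    (hIJ : ∀ U : X.affineOpens, ∀ a ∈ I.ideal U, φ.app U.1 a ∈ J.ideal U) (n : ℕ)
    {s : tensorPowerSections L (p * n)}
    (hs : (s : ∀ x : X, stalkTensorAlgebra L x) ∈ twistedSections I L (p * n)) :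
    (φ.sectionSplit hL n s : ∀ x : X, stalkTensorAlgebra L x) ∈ twistedSections J L n := by
  intro x
  obtain ⟨U, hU, hsU⟩ := hs x
  -- `V` must be affine, because ideals of sections, and the hypothesis on `φ`, are given on affine
  -- opens. The generator is needed in two forms: over `V`, to produce a single coefficient `a`, and
  -- at every stalk, where the splitting is defined.
  obtain ⟨V, hV, hVU, t, ht, ht'⟩ := hL.exists_affine_generator x U.1 hU
  obtain ⟨a, haI, ha⟩ := exists_coordinate ht (res_mem_localTwistedTensors hVU hsU)
  refine ⟨V, hV, ?_⟩
  -- The family `φ a • t^n` lies in `J · L^n` over `V` because `φ a ∈ J(V)`. What remains is to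
  -- identify it, stalk by stalk, with the image of `s`.
  convert smul_pow_mem_localTwistedTensors n (hIJ V a haI) t using 1
  funext y
  have h1 : TensorAlgebra.ι (X.presheaf.stalk y.1) (germ L y.1 y.2 t) ^ n ∈
      tensorPower (X.presheaf.stalk y.1) (stalk L y.1) n :=
    (mem_tensorPower (ht' y.1 y.2)).2 ⟨1, by simp⟩
  -- The splitting at `y` was built from some chosen generator of the stalk, not from the germ of
  -- `t`. No comparison of generators is needed, since the formula `a • s^p ↦ φ a • s` holds for
  -- every `s`; here `s = t^n`.
  have h2 := tensorPowerSplit_smul_pthPower (φ.stalkMap y.1) (φ.stalkMap_pow_mul y.1)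
    (hL.exists_stalk_generator y.1) n (X.presheaf.germ V.1 y.1 y.2 a) ⟨_, h1⟩
  rw [stalkMap_germ] at h2
  refine Eq.trans ?_ congr(($h2 : stalkTensorAlgebra L y.1))
  -- It remains to see that the argument of the splitting, the value of `s` at `y`, equals `a •
  -- (t^n)^p`; this is the coordinate expression `ha`, up to writing `(t^n)^p` as `t^{pn}`.
  refine congr((tensorPowerSplit (φ.stalkMap y.1) (φ.stalkMap_pow_mul y.1)
    (hL.exists_stalk_generator y.1) n $(?_) : stalkTensorAlgebra L y.1))
  ext
  simp only [pthPower, Submodule.coe_smul, ← pow_mul]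
  rw [mul_comm n p]
  exact ha y

end FrobeniusSplit.FrobeniusSplitting

theorem mainTheorem8 {k : Type u} [Field k] [IsAlgClosed k] (p : ℕ) [Fact p.Prime] [CharP k p]
    {X Y : Scheme.{u}} (f : X ⟶ Spec (CommRingCat.of k)) [Smooth f]
    (hf : FrobeniusSplit.IsProjective f)
    (L : X.Modules) (hL : FrobeniusSplit.IsInvertible L)
    (i : Y ⟶ X) [IsClosedImmersion i] [Smooth (i ≫ f)]
    (φ : FrobeniusSplit.FrobeniusSplitting X p)
    (hφ : φ.MaximallyCompatiblySplits i.ker) (m : ℕ) :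
    Set.MapsTo (φ.sectionRingSplit hL)
      (FrobeniusSplit.vanishingIdeal i.ker L (p * m + 1))
      (FrobeniusSplit.vanishingIdeal i.ker L (m + 1)) := by
  -- Membership in the ideals `J` is tested degree by degree, and the degree `n` component of the
  -- image of `r` is by definition `sectionSplit` of its component in degree `p * n`. The components
  -- of `r` in degrees prime to `p` therefore never enter.
  intro r hr n
  exact φ.sectionSplit_mem_twistedSections hL (hφ m) n (hr (p * n))
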